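/- Let $(\mathcal H,\langle\cdot,\cdot\rangle)$ be a complex Hilbert space, with inner product antilinear in its first entry. A (linear) relation in $\mathcal H$ is a linear subset $A\subseteq\mathcal H\oplus\mathcal H$, not necessarily closed; a relation $S$ is an extension of $A$ if $A\subseteq S$. The adjoint of $A$ is the relation $$A^*=\{(h,k)\in\mathcal H\oplus\mathcal H : \langle k,f\rangle=\langle h,g\rangle \text{ for all } (f,g)\in A\},$$ and $A$ is selfadjoint if $A=A^*$. The relation $A$ is lower semi-bounded if there is $m\in\mathbb R$ such that, for all $(f,g)\in A$, the number $\langle f,g\rangle$ is real and $\langle f,g\rangle\ge m\|f\|^2$; it is upper semi-bounded if $-A=\{(f,-g):(f,g)\in A\}$ is lower semi-bounded. Then every lower (resp. upper) semi-bounded relation in $\mathcal H$ has a lower (resp. upper) semi-bounded selfadjoint extension in $\mathcal H\oplus\mathcal H$. -/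

import Mathlib

/-- A linear relation in `H`: a linear subset, not necessarily closed, of `H ⊕ H`. A pair
`(f, g)` in the relation is to be thought of as `g` being one of the values at `f`. -/
abbrev LinearRelation (H : Type*) [NormedAddCommGroup H] [InnerProductSpace ℂ H] :=
  Submodule ℂ (H × H)

namespace LinearRelation

variable {H : Type*} [NormedAddCommGroup H] [InnerProductSpace ℂ H]

/-- The relation `-A = {(f, -g) : (f, g) ∈ A}`. -/
def negRel (A : LinearRelation H) : LinearRelation H :=
  A.map (LinearMap.prodMap LinearMap.id (-LinearMap.id) : H × H →ₗ[ℂ] H × H)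

/-- The adjoint relation `A* = {(h, k) : ⟪k, f⟫ = ⟪h, g⟫ for all (f, g) ∈ A}`; this is Mathlib's
adjoint of a linear subset of `H × H`. -/
noncomputable def adj (A : LinearRelation H) : LinearRelation H :=
  Submodule.adjoint A

/-- `A` is selfadjoint: `A = A*`. -/
def IsSelfadjointRel (A : LinearRelation H) : Prop :=
  A = adj A

/-- `A` is lower semi-bounded: for some real `m`, `⟪f, g⟫ ≥ m ‖f‖²` for all `(f, g) ∈ A`. The
inequality between the complex number `⟪f, g⟫` and a real number includes that `⟪f, g⟫` is real. -/
def IsLowerSemibounded (A : LinearRelation H) : Prop :=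
  ∃ m : ℝ, ∀ f g : H, (f, g) ∈ A →
    (inner ℂ f g).im = 0 ∧ m * ‖f‖ ^ 2 ≤ (inner ℂ f g).re

/-- `A` is upper semi-bounded: `-A` is lower semi-bounded. -/
def IsUpperSemibounded (A : LinearRelation H) : Prop :=
  IsLowerSemibounded (negRel A)

theorem mem_negRel (A : LinearRelation H) (f g : H) : (f, g) ∈ negRel A ↔ (f, -g) ∈ A := by
  simp only [negRel, Submodule.mem_map, Prod.exists, LinearMap.prodMap_apply, LinearMap.id_apply,
    LinearMap.neg_apply, Prod.mk.injEq]
  constructor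
  · rintro ⟨a, b, hab, rfl, rfl⟩
    simpa using hab
  · intro h
    exact ⟨f, -g, h, rfl, neg_neg g⟩

theorem mem_adj (A : LinearRelation H) (h k : H) :
    (h, k) ∈ adj A ↔ ∀ f g : H, (f, g) ∈ A → inner ℂ k f = inner ℂ h g := by
  simp only [adj, Submodule.mem_adjoint_iff, sub_eq_zero]
  refine forall_congr' fun f => forall_congr' fun g => imp_congr_right fun _ => ?_
  rw [← inner_conj_symm g h, ← inner_conj_symm f k, (starRingEnd ℂ).injective.eq_iff, eq_comm]

end LinearRelation

/-! With lower bound `m`, the form `⟪f, g' + (1 - m) f'⟫` on `A` itself is positive semidefinite and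
dominates `‖f‖²`. So `V : (f, g) ↦ f` extends to a contraction `W` on the completion, and `T = W W*`
is positive with `T (g + (1 - m) f) = f` on `A`. Hence `A` lies in the selfadjoint relation `T⁻¹ -
(1 - m)`, bounded below by `m - 1`. The upper case follows by negation. -/

/-- Let `V G : E → H` be linear maps out of a semi-inner product space such that `V` is
contractive and `⟪x, y⟫ = ⟪V x, G y⟫`. Then the correspondence `G x ↦ V x` extends to a positive
bounded operator on `H`, namely `V V*` with `V` extended to the completion of `E`. -/
theorem exists_isPositive_apply_eq_of_contraction {E H : Type*}
    [SeminormedAddCommGroup E] [InnerProductSpace ℂ E]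
    [NormedAddCommGroup H] [InnerProductSpace ℂ H] [CompleteSpace H] (V G : E →ₗ[ℂ] H)
    (hV : ∀ x, ‖V x‖ ≤ ‖x‖) (hG : ∀ x y, inner ℂ x y = inner ℂ (V x) (G y)) :
    ∃ T : H →L[ℂ] H, T.IsPositive ∧ ∀ x, T (G x) = V x := by
  let W : UniformSpace.Completion E →L[ℂ] H :=
    (V.mkContinuous 1 (by simpa using hV)).extend (UniformSpace.Completion.toComplL (𝕜 := ℂ))
  have hW : ∀ x : E, W x = V x := fun x =>
    ContinuousLinearMap.extend_eq _ UniformSpace.Completion.denseRange_coe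
      (UniformSpace.Completion.isUniformInducing_coe E) x
  have hadj : ∀ x : E, W.adjoint (G x) = x := by
    intro x
    -- By density, test on `y` in `E`: `⟪y, W* G x⟫ = ⟪V y, G x⟫ = ⟪y, x⟫`.
    refine ext_inner_left ℂ fun v => ?_
    induction v using UniformSpace.Completion.induction_on with
    | hp => exact isClosed_eq (by fun_prop) (by fun_prop)
    | ih y => rw [ContinuousLinearMap.adjoint_inner_right, hW, UniformSpace.Completion.inner_coe, hG]
  exact ⟨W ∘L W.adjoint, ContinuousLinearMap.isPositive_self_comp_adjoint W, fun x => by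
    rw [ContinuousLinearMap.comp_apply, hadj, hW]⟩

/-- The version of `exists_isPositive_apply_eq_of_contraction` for a positive semidefinite form. -/
theorem PreInnerProductSpace.Core.exists_isPositive_apply_eq {E H : Type*}
    [AddCommGroup E] [Module ℂ E] (c : PreInnerProductSpace.Core ℂ E)
    [NormedAddCommGroup H] [InnerProductSpace ℂ H] [CompleteSpace H] (V G : E →ₗ[ℂ] H)
    (hV : ∀ x, ‖V x‖ ^ 2 ≤ (c.inner x x).re) (hG : ∀ x y, c.inner x y = inner ℂ (V x) (G y)) :
    ∃ T : H →L[ℂ] H, T.IsPositive ∧ ∀ x, T (G x) = V x := by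
  let _ : SeminormedAddCommGroup E := InnerProductSpace.Core.toSeminormedAddCommGroup (𝕜 := ℂ)
  let _ : InnerProductSpace ℂ E := InnerProductSpace.ofCore c
  exact exists_isPositive_apply_eq_of_contraction V G
    (fun x => Real.le_sqrt_of_sq_le (hV x)) hG

namespace LinearRelation

section

variable {H : Type*} [NormedAddCommGroup H] [InnerProductSpace ℂ H]

/-- A relation whose quadratic form is real is symmetric. -/
theorem inner_eq_inner_of_im_eq_zero {A : LinearRelation H}
    (hA : ∀ f g : H, (f, g) ∈ A → (inner ℂ f g).im = 0) {f g h k : H}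
    (hfg : (f, g) ∈ A) (hhk : (h, k) ∈ A) : inner ℂ f k = inner ℂ g h := by
  -- Polarization: the sum yields the imaginary part, the sum with factor `I` the real part.
  have h₁ := hA _ _ (A.add_mem hfg hhk)
  have h₂ := hA _ _ (A.add_mem hfg (A.smul_mem Complex.I hhk))
  have hf := hA _ _ hfg
  have hh := hA _ _ hhk
  simp only [inner_add_left, inner_add_right, inner_smul_left, inner_smul_right,
    Prod.smul_fst, Prod.smul_snd, Complex.add_im, Complex.add_re, Complex.mul_im,
    Complex.mul_re, Complex.I_re, Complex.I_im, Complex.conj_I, Complex.neg_re, Complex.neg_im]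
    at h₁ h₂
  rw [← inner_conj_symm g h]
  apply Complex.ext
  · rw [Complex.conj_re]; linarith
  · rw [Complex.conj_im]; linarith

theorem inner_add_ofReal_smul_self (f g : H) (c : ℝ) :
    inner ℂ f (g + (c : ℂ) • f) = inner ℂ f g + ((c * ‖f‖ ^ 2 : ℝ) : ℂ) := by
  rw [inner_add_right, inner_smul_right, inner_self_eq_norm_sq_to_K]
  push_cast
  rfl

/-- The relation `T⁻¹ - c` for a bounded operator `T` and a real number `c`. -/
def invSub (T : H →L[ℂ] H) (c : ℝ) : LinearRelation H :=
  LinearMap.ker ((LinearMap.fst ℂ H H) -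
    T.toLinearMap ∘ₗ (LinearMap.snd ℂ H H + (c : ℂ) • LinearMap.fst ℂ H H))

theorem mem_invSub (T : H →L[ℂ] H) (c : ℝ) (f g : H) :
    (f, g) ∈ invSub T c ↔ T (g + (c : ℂ) • f) = f := by
  rw [invSub, LinearMap.mem_ker, LinearMap.sub_apply, sub_eq_zero, eq_comm]
  rfl

theorem isSelfadjointRel_invSub {T : H →L[ℂ] H} (hT : T.IsPositive) (c : ℝ) :
    (invSub T c).IsSelfadjointRel := by
  ext ⟨h, k⟩
  rw [mem_adj, mem_invSub]
  constructor
  · intro hk f g hfg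
    rw [mem_invSub] at hfg
    have := hT.inner_left_eq_inner_right (k + (c : ℂ) • h) (g + (c : ℂ) • f)
    rw [hk, hfg] at this
    rw [inner_add_left, inner_add_right, inner_smul_left, inner_smul_right, Complex.conj_ofReal]
      at this
    exact (add_right_cancel this).symm
  · intro hk
    refine ext_inner_right ℂ fun u => ?_
    -- These pairs, for `u` in `H`, parametrize all of `T⁻¹ - c`.
    have := hk (T u) (u - (c : ℂ) • T u) ((mem_invSub ..).2 (by simp))
    rw [hT.inner_left_eq_inner_right, inner_add_left, this, inner_sub_right,
      inner_smul_left, inner_smul_right, Complex.conj_ofReal, sub_add_cancel]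

/-- With `u = g + c f` and `f = T u`, positivity reads `⟪f, g⟫ + c ‖f‖² = ⟪T u, u⟫ ≥ 0`. -/
theorem isLowerSemibounded_invSub {T : H →L[ℂ] H} (hT : T.IsPositive) (c : ℝ) :
    (invSub T c).IsLowerSemibounded := by
  refine ⟨-c, fun f g hfg => ?_⟩
  rw [mem_invSub] at hfg
  have hpos := hT.inner_nonneg_left (g + (c : ℂ) • f)
  rw [hfg, inner_add_ofReal_smul_self, Complex.nonneg_iff] at hpos
  obtain ⟨hre, him⟩ := hpos
  simp only [Complex.add_re, Complex.add_im, Complex.ofReal_re, Complex.ofReal_im] at hre him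
  exact ⟨by linarith, by linarith⟩

/-- The form `⟪f, g' + (1 - m) f'⟫` on a relation with lower bound `m`. -/
noncomputable abbrev formCore (A : LinearRelation H) (m : ℝ)
    (hA : ∀ f g : H, (f, g) ∈ A → (inner ℂ f g).im = 0 ∧ m * ‖f‖ ^ 2 ≤ (inner ℂ f g).re) :
    PreInnerProductSpace.Core ℂ A where
  inner x y := inner ℂ x.1.1 (y.1.2 + ((1 - m : ℝ) : ℂ) • y.1.1)
  conj_inner_symm x y := by
    have := inner_eq_inner_of_im_eq_zero (fun f g h => (hA f g h).1) x.2 y.2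
    rw [inner_conj_symm, inner_add_left, inner_add_right, inner_smul_left, inner_smul_right, this,
      Complex.conj_ofReal]
  re_inner_nonneg x := by
    have := (hA x.1.1 x.1.2 x.2).2
    rw [inner_add_ofReal_smul_self]
    simp only [RCLike.re_to_complex, Complex.add_re, Complex.ofReal_re]
    nlinarith [sq_nonneg ‖x.1.1‖]
  add_left x y z := inner_add_left _ _ _
  smul_left x y r := inner_smul_left _ _ _

theorem IsLowerSemibounded.exists_selfadjoint_extension [CompleteSpace H] {A : LinearRelation H}
    (hA : A.IsLowerSemibounded) :
    ∃ S : LinearRelation H, A ≤ S ∧ S.IsSelfadjointRel ∧ S.IsLowerSemibounded := by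
  obtain ⟨m, hm⟩ := hA
  obtain ⟨T, hT, hTA⟩ := (formCore A m hm).exists_isPositive_apply_eq
    (LinearMap.fst ℂ H H ∘ₗ A.subtype)
    -- The shift by `-m` makes the form nonnegative; the extra `1` makes `V` contractive.
    ((LinearMap.snd ℂ H H + ((1 - m : ℝ) : ℂ) • LinearMap.fst ℂ H H) ∘ₗ A.subtype)
    (fun x => by
      have := (hm x.1.1 x.1.2 x.2).2
      change ‖x.1.1‖ ^ 2 ≤ (inner ℂ x.1.1 (x.1.2 + ((1 - m : ℝ) : ℂ) • x.1.1)).re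
      rw [inner_add_ofReal_smul_self]
      simp only [Complex.add_re, Complex.ofReal_re]
      linarith)
    (fun x y => rfl)
  refine ⟨invSub T (1 - m), ?_, isSelfadjointRel_invSub hT _, isLowerSemibounded_invSub hT _⟩
  rintro ⟨f, g⟩ hfg
  exact (mem_invSub ..).2 (hTA ⟨(f, g), hfg⟩)

theorem negRel_negRel (A : LinearRelation H) : negRel (negRel A) = A := by
  ext ⟨f, g⟩
  simp [mem_negRel]

theorem adj_negRel (A : LinearRelation H) : adj (negRel A) = negRel (adj A) := by
  ext ⟨h, k⟩
  simp only [mem_adj, mem_negRel]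
  constructor
  · intro hk f g hfg
    have := hk f (-g) (by simpa using hfg)
    rw [inner_neg_left, this, inner_neg_right, neg_neg]
  · intro hk f g hfg
    have := hk f (-g) hfg
    rwa [inner_neg_left, inner_neg_right, neg_inj] at this

end

end LinearRelation

theorem mainTheorem10 {H : Type*} [NormedAddCommGroup H] [InnerProductSpace ℂ H]
    [CompleteSpace H] (A : LinearRelation H) :
    (A.IsLowerSemibounded →
      ∃ S : LinearRelation H, A ≤ S ∧ S.IsSelfadjointRel ∧ S.IsLowerSemibounded) ∧
    (A.IsUpperSemibounded →
      ∃ S : LinearRelation H, A ≤ S ∧ S.IsSelfadjointRel ∧ S.IsUpperSemibounded) := by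
  refine ⟨fun hA => hA.exists_selfadjoint_extension, fun hA => ?_⟩
  obtain ⟨S, hAS, hS, hSb⟩ := LinearRelation.IsLowerSemibounded.exists_selfadjoint_extension hA
  refine ⟨S.negRel, ?_, ?_, ?_⟩
  · rw [← A.negRel_negRel]
    exact Submodule.map_mono hAS
  · rw [LinearRelation.IsSelfadjointRel, LinearRelation.adj_negRel, ← hS]
  · rwa [LinearRelation.IsUpperSemibounded, LinearRelation.negRel_negRel]
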